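/- Let $\mathbb K=\mathbb R$ or $\mathbb C$. Let $V$ be a $\mathbb K$-analytic manifold of dimension $n$, let $E$ and $F$ be $\mathbb K$-analytic vector bundles over $V$ of ranks $p$ and $q$, let $k\ge 1$, and let $D:J^kE\to F$ be a linear homogeneous differential operator of order $k$, i.e. a $\mathbb K$-analytic morphism of vector bundles from the bundle $J^kE$ of $k$-jets of sections of $E$ to $F$. For $h\ge k$ let $D_h:J^hE\to J^{h-k}F$, $D_h(j^hs)=j^{h-k}(D(j^ks))$, be the $(h-k)$-th prolongation of $D$, and let the principal symbol $\sigma_h(D):S^hT^*V\otimes E\to S^{h-k}T^*V\otimes F$ be the restriction of $D_h$ to the kernel of $J^hE\to J^{h-1}E$. Put $c(n,h)=\frac{(n-1+h)!}{(n-1)!\,h!}$ and $\varphi(h)=\frac{c(n,h-k)}{c(n,h)}$. Assume that $D$ is ordinary, i.e. that at every point of $V$ and for every $h\ge k$ the symbol $\sigma_h(D)$ has the maximal rank $\inf\bigl(q\,c(n,h-k),\,p\,c(n,h)\bigr)$, and that $p<q\le p\,c(n,k)$. Then there is a biggest integer $h_0\ge k$ with $p\,c(n,h_0)\ge q\,c(n,h_0-k)$,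 and for every point $m\in V$ the space $\mathcal S_m$ of germs at $m$ of analytic sections $s$ of $E$ with $D(j^ks)=0$ is a finite-dimensional $\mathbb K$-vector space, of dimension at most $$\pi(n,k,p,q)=p\,c(n+1,h_0)-q\,c(n+1,h_0-k)=p\,c(n+1,k-1)+\sum_{h=k}^{h_0}\binom{n-1+h}{h}\bigl(p-q\,\varphi(h)\bigr).$$ Moreover a germ of solution at $m$ is determined by its $h_0$-jet at $m$: two elements of $\mathcal S_m$ with the same $h_0$-jet at $m$ are equal. -/

import Mathlib

open Bundle Filter Topology Module
open scoped Manifold ContDiff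

noncomputable section

namespace JetPDE

/-! ### Numbers -/

/-- `c(n,h) = (n-1+h)! / ((n-1)! h!)` (for `n ≥ 1`): the number of monomials of degree `h` in
`n` variables. -/
def c (n h : ℕ) : ℕ := Nat.choose (n - 1 + h) h

/-- The integer `h₀`: the biggest `h ≥ k` such that `p c(n,h) ≥ q c(n,h-k)`. -/
def h₀ (n k p q : ℕ) : ℕ := sSup {h : ℕ | k ≤ h ∧ q * c n (h - k) ≤ p * c n h}

/-- `π(n,k,p,q) = p c(n+1,h₀) - q c(n+1,h₀-k)`, an integer. -/
def piBound (n k p q : ℕ) : ℤ :=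
  (p : ℤ) * (c (n + 1) (h₀ n k p q) : ℤ) - (q : ℤ) * (c (n + 1) (h₀ n k p q - k) : ℤ)

/-- `φ(h) = c(n,h-k) / c(n,h)`. -/
def phi (n k h : ℕ) : ℚ := (c n (h - k) : ℚ) / (c n h : ℚ)

/-! ### Functions whose derivatives of order `< r` vanish at a point -/

section Vanish

variable {𝕜 : Type*} [RCLike 𝕜]
  {B : Type*} [NormedAddCommGroup B] [NormedSpace 𝕜 B]
  {G : Type*} [NormedAddCommGroup G] [NormedSpace 𝕜 G]
  {G' : Type*} [NormedAddCommGroup G'] [NormedSpace 𝕜 G']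

/-- All derivatives of `f` of order `< r` vanish at `y`. -/
def VanishesToOrder (𝕜 : Type*) [RCLike 𝕜] {B : Type*} [NormedAddCommGroup B] [NormedSpace 𝕜 B]
    {G : Type*} [NormedAddCommGroup G] [NormedSpace 𝕜 G] (r : ℕ) (f : B → G) (y : B) : Prop :=
  ∀ i < r, iteratedFDeriv 𝕜 i f y = 0

lemma VanishesToOrder.mono {r r' : ℕ} {f : B → G} {y : B} (h : VanishesToOrder 𝕜 r f y)
    (hr : r' ≤ r) : VanishesToOrder 𝕜 r' f y := fun i hi => h i (hi.trans_le hr)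

lemma VanishesToOrder.congr {r : ℕ} {f g : B → G} {y : B} (h : VanishesToOrder 𝕜 r f y)
    (hfg : f =ᶠ[𝓝 y] g) : VanishesToOrder 𝕜 r g y := fun i hi => by
  rw [← (hfg.iteratedFDeriv (𝕜 := 𝕜) i).eq_of_nhds]; exact h i hi

lemma vanishesToOrder_zero (r : ℕ) (y : B) : VanishesToOrder 𝕜 r (fun _ : B => (0 : G)) y :=
  fun i _ => by
    have : iteratedFDeriv 𝕜 i (fun _ : B => (0 : G)) = 0 := by simp
    rw [this]; rfl

lemma VanishesToOrder.add {r : ℕ} {f g : B → G} {y : B} (hf : ContDiffAt 𝕜 ω f y)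
    (hg : ContDiffAt 𝕜 ω g y) (h : VanishesToOrder 𝕜 r f y) (h' : VanishesToOrder 𝕜 r g y) :
    VanishesToOrder 𝕜 r (fun z => f z + g z) y := fun i hi => by
  have := iteratedFDeriv_add_apply (𝕜 := 𝕜) (i := i) (hf.of_le le_top) (hg.of_le le_top)
  have e : (f + g) = fun z => f z + g z := rfl
  rw [e] at this
  rw [this, h i hi, h' i hi, add_zero]

lemma VanishesToOrder.const_smul {r : ℕ} {f : B → G} {y : B} (hf : ContDiffAt 𝕜 ω f y)
    (h : VanishesToOrder 𝕜 r f y) (a : 𝕜) :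
    VanishesToOrder 𝕜 r (fun z => a • f z) y := fun i hi => by
  have := iteratedFDeriv_const_smul_apply' (𝕜 := 𝕜) (i := i) (a := a) (hf.of_le le_top)
  rw [this, h i hi, smul_zero]

lemma norm_iteratedFDeriv_iteratedFDeriv (f : B → G) (y : B) (i j : ℕ) :
    ‖iteratedFDeriv 𝕜 j (iteratedFDeriv 𝕜 i f) y‖ = ‖iteratedFDeriv 𝕜 (i + j) f y‖ := by
  induction i generalizing j with
  | zero =>
    rw [iteratedFDeriv_zero_eq_comp, LinearIsometryEquiv.norm_iteratedFDeriv_comp_left, zero_add]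
  | succ i ih =>
    obtain ⟨e, he⟩ : ∃ e : (B →L[𝕜] (B [×i]→L[𝕜] G)) ≃ₗᵢ[𝕜] (B [×(i + 1)]→L[𝕜] G),
        iteratedFDeriv 𝕜 (i + 1) f = e ∘ fderiv 𝕜 (iteratedFDeriv 𝕜 i f) :=
      ⟨(continuousMultilinearCurryLeftEquiv 𝕜 (fun _ : Fin (i + 1) => B) G).symm, rfl⟩
    rw [he, LinearIsometryEquiv.norm_iteratedFDeriv_comp_left (𝕜 := 𝕜) (E := B)
      (F := B →L[𝕜] (B [×i]→L[𝕜] G)) (G := B [×(i + 1)]→L[𝕜] G) e]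
    rw [norm_iteratedFDeriv_fderiv, ih, show i + (j + 1) = i + 1 + j by omega]

lemma VanishesToOrder.iteratedFDeriv {r i : ℕ} {f : B → G} {y : B}
    (h : VanishesToOrder 𝕜 (i + r) f y) :
    VanishesToOrder 𝕜 r (iteratedFDeriv 𝕜 i f) y := fun j hj => by
  rw [← norm_eq_zero, norm_iteratedFDeriv_iteratedFDeriv, h _ (by omega), norm_zero]

lemma VanishesToOrder.clm_apply {r : ℕ} {a : B → G →L[𝕜] G'} {g : B → G} {y : B}
    (ha : ContDiffAt 𝕜 ω a y) (hg : ContDiffAt 𝕜 ω g y) (h : VanishesToOrder 𝕜 r g y) :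
    VanishesToOrder 𝕜 r (fun z => a z (g z)) y := fun i hi => by
  obtain ⟨w, hw, hwo, hyw⟩ := mem_nhds_iff.1
    (Filter.inter_mem (ha.eventually (by simp)) (hg.eventually (by simp)))
  have hau : ContDiffOn 𝕜 i a w := fun z hz =>
    (show ContDiffAt 𝕜 ω a z from (hw hz).1).contDiffWithinAt.of_le le_top
  have hgv : ContDiffOn 𝕜 i g w := fun z hz =>
    (show ContDiffAt 𝕜 ω g z from (hw hz).2).contDiffWithinAt.of_le le_top
  have hb := ContinuousLinearMap.norm_iteratedFDerivWithin_le_of_bilinear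
    (ContinuousLinearMap.id 𝕜 (G →L[𝕜] G')) hau hgv
    hwo.uniqueDiffOn hyw (n := i) le_rfl
  rw [← norm_eq_zero]
  refine le_antisymm ?_ (norm_nonneg _)
  rw [← iteratedFDerivWithin_of_isOpen i hwo hyw]
  refine hb.trans (le_of_eq ?_)
  rw [Finset.sum_eq_zero, mul_zero]
  intro j _
  rw [iteratedFDerivWithin_of_isOpen (i - j) hwo hyw, h _ (by omega), norm_zero, mul_zero]

end Vanish

/-! ### Germs of analytic sections and jets -/

section Sections

variable (𝕜 : Type*) [RCLike 𝕜]
  (B : Type*) [NormedAddCommGroup B] [NormedSpace 𝕜 B]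
  {V : Type*} [TopologicalSpace V] [ChartedSpace B V]
  (FE : Type*) [NormedAddCommGroup FE] [NormedSpace 𝕜 FE]
  (E : V → Type*) [TopologicalSpace (TotalSpace FE E)]
  [∀ x, AddCommGroup (E x)] [∀ x, Module 𝕜 (E x)] [∀ x, TopologicalSpace (E x)]
  [FiberBundle FE E] [VectorBundle 𝕜 FE E]

/-- The sections of `E` which are analytic near `m`. (They are functions on the whole of `V`, with
arbitrary values away from `m`.) -/
def analyticSections (m : V) : Submodule 𝕜 (Π x, E x) where
  carrier := {s | ContMDiffAt 𝓘(𝕜, B) (𝓘(𝕜, B).prod 𝓘(𝕜, FE)) ω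
    (fun x => TotalSpace.mk' FE x (s x)) m}
  add_mem' hs ht := ContMDiffAt.add_section hs ht
  zero_mem' := contMDiffAt_zeroSection 𝕜 E
  smul_mem' a _ hs := ContMDiffAt.const_smul_section (a := a) hs

/-- The sections analytic near `m` which vanish on a neighbourhood of `m`. -/
def nullSections (m : V) : Submodule 𝕜 (analyticSections 𝕜 B FE E m) where
  carrier := {s | ∀ᶠ x in 𝓝 m, s.1 x = 0}
  add_mem' {s t} hs ht := by
    filter_upwards [hs, ht] with x h h'
    change s.1 x + t.1 x = 0
    rw [h, h', add_zero]
  zero_mem' := Eventually.of_forall fun _ => rfl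
  smul_mem' a s hs := by
    filter_upwards [hs] with x h
    change a • s.1 x = 0
    rw [h, smul_zero]

/-- The space of germs at `m` of analytic sections of `E`. -/
abbrev SectionGerm (m : V) : Type _ := analyticSections 𝕜 B FE E m ⧸ nullSections 𝕜 B FE E m

variable {E} in
/-- The section `s` near `m`, read in the preferred chart and trivialization at `m`: a function
from (an open subset of) the model space `B` to the model fibre `FE`. -/
def localRep (m : V) (s : Π x, E x) : B → FE := fun y =>
  (trivializationAt FE E m (TotalSpace.mk' FE ((extChartAt 𝓘(𝕜, B) m).symm y)
    (s ((extChartAt 𝓘(𝕜, B) m).symm y)))).2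

variable {E} in
lemma localRep_eq (m : V) (s : Π x, E x) :
    localRep 𝕜 B FE m s =ᶠ[𝓝 (extChartAt 𝓘(𝕜, B) m m)] fun y =>
      (trivializationAt FE E m).continuousLinearMapAt 𝕜 ((extChartAt 𝓘(𝕜, B) m).symm y)
        (s ((extChartAt 𝓘(𝕜, B) m).symm y)) := by
  have hc : ContinuousAt (extChartAt 𝓘(𝕜, B) m).symm (extChartAt 𝓘(𝕜, B) m m) :=
    continuousAt_extChartAt_symm m
  have hb : (trivializationAt FE E m).baseSet ∈
      𝓝 ((extChartAt 𝓘(𝕜, B) m).symm (extChartAt 𝓘(𝕜, B) m m)) := by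
    rw [extChartAt_to_inv]
    exact (trivializationAt FE E m).open_baseSet.mem_nhds
      (FiberBundle.mem_baseSet_trivializationAt' m)
  filter_upwards [hc.eventually hb] with y hy
  have hy' : (extChartAt 𝓘(𝕜, B) m).symm y ∈ (trivializationAt FE E m).baseSet := hy
  rw [Trivialization.continuousLinearMapAt_apply, Trivialization.linearMapAt_apply, if_pos hy']
  rfl

variable {E} in
lemma contDiffAt_localRep {m : V} {s : Π x, E x} (hs : s ∈ analyticSections 𝕜 B FE E m) :
    ContDiffAt 𝕜 ω (localRep 𝕜 B FE m s) (extChartAt 𝓘(𝕜, B) m m) := by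
  have h := (contMDiffAt_section m).1 hs
  have h2 := contMDiffAt_iff_source.1 h
  rw [modelWithCornersSelf_coe, Set.range_id, contMDiffWithinAt_univ, contMDiffAt_iff_contDiffAt]
    at h2
  exact h2

/-- The sections analytic near `m` all of whose derivatives of order `< r` vanish at `m`. -/
def vanishing (m : V) (r : ℕ) : Submodule 𝕜 (analyticSections 𝕜 B FE E m) where
  carrier := {s | VanishesToOrder 𝕜 r (localRep 𝕜 B FE m s.1) (extChartAt 𝓘(𝕜, B) m m)}
  add_mem' {s t} hs ht := by
    refine (VanishesToOrder.add (contDiffAt_localRep 𝕜 B FE s.2)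
      (contDiffAt_localRep 𝕜 B FE t.2) hs ht).congr ?_
    filter_upwards [localRep_eq 𝕜 B FE m s.1, localRep_eq 𝕜 B FE m t.1,
      localRep_eq 𝕜 B FE m (s + t).1] with y h1 h2 h3
    rw [h1, h2, h3]
    exact (map_add _ _ _).symm
  zero_mem' := by
    refine (vanishesToOrder_zero (𝕜 := 𝕜) r _).congr ?_
    filter_upwards [localRep_eq 𝕜 B FE m (0 : Π x, E x)] with y h1
    exact (h1.trans (map_zero _)).symm
  smul_mem' a s hs := by
    refine (VanishesToOrder.const_smul (contDiffAt_localRep 𝕜 B FE s.2) hs a).congr ?_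
    filter_upwards [localRep_eq 𝕜 B FE m s.1, localRep_eq 𝕜 B FE m (a • s).1] with y h1 h2
    rw [h1, h2]
    exact (map_smul _ _ _).symm

variable {E} in
lemma localRep_eventuallyEq_zero {m : V} {s : Π x, E x} (hs : ∀ᶠ x in 𝓝 m, s x = 0) :
    localRep 𝕜 B FE m s =ᶠ[𝓝 (extChartAt 𝓘(𝕜, B) m m)] fun _ => 0 := by
  have hc : ContinuousAt (extChartAt 𝓘(𝕜, B) m).symm (extChartAt 𝓘(𝕜, B) m m) :=
    continuousAt_extChartAt_symm m
  have hs' : ∀ᶠ x in 𝓝 ((extChartAt 𝓘(𝕜, B) m).symm (extChartAt 𝓘(𝕜, B) m m)), s x = 0 := by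
    rwa [extChartAt_to_inv]
  filter_upwards [localRep_eq 𝕜 B FE m s, hc.eventually hs'] with y h1 h2
  rw [h1, h2, map_zero]

lemma nullSections_le_vanishing (m : V) (r : ℕ) :
    nullSections 𝕜 B FE E m ≤ vanishing 𝕜 B FE E m r := fun s hs =>
  (vanishesToOrder_zero (𝕜 := 𝕜) r _).congr (localRep_eventuallyEq_zero 𝕜 B FE (s := s.1) hs).symm

/-- The fibre at `m` of the bundle `J^h E` of `h`-jets of sections of `E`: sections near `m`, modulo
those whose derivatives of order `≤ h` all vanish at `m`. -/
abbrev Jet (h : ℕ) (m : V) : Type _ :=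
  analyticSections 𝕜 B FE E m ⧸ vanishing 𝕜 B FE E m (h + 1)

/-- The subspace `S^h T^*(V)_m ⊗ E_m` of `(J^h E)_m`: the kernel of the projection
`(J^h E)_m → (J^{h-1} E)_m` (the whole of `(J^0 E)_m` when `h = 0`), i.e. the `h`-jets of the
sections whose derivatives of order `≤ h - 1` vanish at `m`. -/
def topJet (h : ℕ) (m : V) : Submodule 𝕜 (Jet 𝕜 B FE E h m) :=
  (vanishing 𝕜 B FE E m h).map (vanishing 𝕜 B FE E m (h + 1)).mkQ

/-- The `h`-jet at `m` of a germ at `m`. -/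
def SectionGerm.jet (h : ℕ) (m : V) : SectionGerm 𝕜 B FE E m →ₗ[𝕜] Jet 𝕜 B FE E h m :=
  Submodule.factor (nullSections_le_vanishing 𝕜 B FE E m (h + 1))

variable {E} in
open Classical in
/-- The `h`-jet `j^h s` at `x` of a section `s` which is analytic near `x`
(and `0` if `s` is not analytic near `x`). -/
def jetAt (h : ℕ) (s : Π x, E x) (x : V) : Jet 𝕜 B FE E h x :=
  if hs : s ∈ analyticSections 𝕜 B FE E x then
    (vanishing 𝕜 B FE E x (h + 1)).mkQ ⟨s, hs⟩ else 0

variable {E} in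
lemma jetAt_of_mem (h : ℕ) {s : Π x, E x} {x : V} (hs : s ∈ analyticSections 𝕜 B FE E x) :
    jetAt 𝕜 B FE h s x = (vanishing 𝕜 B FE E x (h + 1)).mkQ ⟨s, hs⟩ := dif_pos hs

variable {E} in
lemma analyticSections_eventually [IsManifold 𝓘(𝕜, B) ω V] [ContMDiffVectorBundle ω FE E 𝓘(𝕜, B)]
    {m : V} {s : Π x, E x} (hs : s ∈ analyticSections 𝕜 B FE E m) :
    ∀ᶠ x in 𝓝 m, s ∈ analyticSections 𝕜 B FE E x :=
  (contMDiffAt_iff_contMDiffAt_nhds (by simp)).1 hs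

end Sections

/-! ### Linear differential operators -/

/-- A linear homogeneous differential operator `D : J^k E → F` of order `k`, i.e. an analytic
morphism of vector bundles from `J^k E` to `F`: a family of linear maps `(J^k E)_x → F_x` which,
near any point `m`, and with respect to the preferred chart of `V` and the preferred trivializations
of `E` and `F` at `m`, is of the form `D(j^k s) = ∑_{i ≤ k} aᵢ(x) ∂ⁱ s(x)`, where the coefficients
`aᵢ` (linear maps from the `i`-linear maps to the fibre) are analytic functions. -/
structure LinDiffOp (𝕜 : Type*) [RCLike 𝕜]
    (B : Type*) [NormedAddCommGroup B] [NormedSpace 𝕜 B]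
    {V : Type*} [TopologicalSpace V] [ChartedSpace B V]
    (FE : Type*) [NormedAddCommGroup FE] [NormedSpace 𝕜 FE]
    (E : V → Type*) [TopologicalSpace (TotalSpace FE E)]
    [∀ x, AddCommGroup (E x)] [∀ x, Module 𝕜 (E x)] [∀ x, TopologicalSpace (E x)]
    [FiberBundle FE E] [VectorBundle 𝕜 FE E]
    (FF : Type*) [NormedAddCommGroup FF] [NormedSpace 𝕜 FF]
    (F : V → Type*) [TopologicalSpace (TotalSpace FF F)]
    [∀ x, AddCommGroup (F x)] [∀ x, Module 𝕜 (F x)] [∀ x, TopologicalSpace (F x)]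
    [FiberBundle FF F] [VectorBundle 𝕜 FF F] (k : ℕ) where
  /-- The linear map from the fibre of `J^k E` at `x` to the fibre of `F` at `x`. -/
  toLin : ∀ x : V, Jet 𝕜 B FE E k x →ₗ[𝕜] F x
  analytic : ∀ m : V, ∃ a : (i : ℕ) → B → ((B [×i]→L[𝕜] FE) →L[𝕜] FF),
    (∀ i, ContDiffAt 𝕜 ω (a i) (extChartAt 𝓘(𝕜, B) m m)) ∧
    ∀ᶠ x in 𝓝 m, ∀ s : analyticSections 𝕜 B FE E x,
      (trivializationAt FF F m
          (TotalSpace.mk' FF x (toLin x ((vanishing 𝕜 B FE E x (k + 1)).mkQ s)))).2 =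
        ∑ i ∈ Finset.range (k + 1), a i (extChartAt 𝓘(𝕜, B) m x)
          (iteratedFDeriv 𝕜 i (localRep 𝕜 B FE m s.1) (extChartAt 𝓘(𝕜, B) m x))

namespace LinDiffOp

variable {𝕜 : Type*} [RCLike 𝕜]
  {B : Type*} [NormedAddCommGroup B] [NormedSpace 𝕜 B]
  {V : Type*} [TopologicalSpace V] [ChartedSpace B V]
  {FE : Type*} [NormedAddCommGroup FE] [NormedSpace 𝕜 FE]
  {E : V → Type*} [TopologicalSpace (TotalSpace FE E)]
  [∀ x, AddCommGroup (E x)] [∀ x, Module 𝕜 (E x)] [∀ x, TopologicalSpace (E x)]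
  [FiberBundle FE E] [VectorBundle 𝕜 FE E]
  {FF : Type*} [NormedAddCommGroup FF] [NormedSpace 𝕜 FF]
  {F : V → Type*} [TopologicalSpace (TotalSpace FF F)]
  [∀ x, AddCommGroup (F x)] [∀ x, Module 𝕜 (F x)] [∀ x, TopologicalSpace (F x)]
  [FiberBundle FF F] [VectorBundle 𝕜 FF F] {k : ℕ}
  (D : LinDiffOp 𝕜 B FE E FF F k)

/-- The section `x ↦ D(j^k_x s)` of `F`. -/
def apply (s : Π x, E x) : Π x, F x := fun x => D.toLin x (jetAt 𝕜 B FE k s x)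

variable [IsManifold 𝓘(𝕜, B) ω V] [ContMDiffVectorBundle ω FE E 𝓘(𝕜, B)]

lemma localRep_apply {m : V} {s : Π x, E x} (hs : s ∈ analyticSections 𝕜 B FE E m) :
    ∃ a : (i : ℕ) → B → ((B [×i]→L[𝕜] FE) →L[𝕜] FF),
    (∀ i, ContDiffAt 𝕜 ω (a i) (extChartAt 𝓘(𝕜, B) m m)) ∧
    (fun x => (trivializationAt FF F m (TotalSpace.mk' FF x (D.apply s x))).2) =ᶠ[𝓝 m] fun x =>
      ∑ i ∈ Finset.range (k + 1), a i (extChartAt 𝓘(𝕜, B) m x)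
          (iteratedFDeriv 𝕜 i (localRep 𝕜 B FE m s) (extChartAt 𝓘(𝕜, B) m x)) := by
  obtain ⟨a, ha, h⟩ := D.analytic m
  refine ⟨a, ha, ?_⟩
  filter_upwards [h, analyticSections_eventually 𝕜 B FE hs] with x hx hsx
  rw [apply, jetAt_of_mem 𝕜 B FE k hsx]
  exact hx ⟨s, hsx⟩

lemma apply_mem {m : V} {s : Π x, E x} (hs : s ∈ analyticSections 𝕜 B FE E m) :
    D.apply s ∈ analyticSections 𝕜 B FF F m := by
  obtain ⟨a, ha, h⟩ := D.localRep_apply hs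
  refine (contMDiffAt_section m).2 (ContMDiffAt.congr_of_eventuallyEq ?_ h)
  have hf : ContDiffAt 𝕜 ω (fun y => ∑ i ∈ Finset.range (k + 1), a i y
      (iteratedFDeriv 𝕜 i (localRep 𝕜 B FE m s) y)) (extChartAt 𝓘(𝕜, B) m m) :=
    ContDiffAt.sum fun i _ => (ha i).clm_apply
      ((contDiffAt_localRep 𝕜 B FE hs).iteratedFDeriv_right (by simp))
  exact hf.contMDiffAt.comp m contMDiffAt_extChartAt

lemma localRep_apply_chart {m : V} {s : Π x, E x} (hs : s ∈ analyticSections 𝕜 B FE E m) :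
    ∃ a : (i : ℕ) → B → ((B [×i]→L[𝕜] FE) →L[𝕜] FF),
    (∀ i, ContDiffAt 𝕜 ω (a i) (extChartAt 𝓘(𝕜, B) m m)) ∧
    localRep 𝕜 B FF m (D.apply s) =ᶠ[𝓝 (extChartAt 𝓘(𝕜, B) m m)] fun y =>
      ∑ i ∈ Finset.range (k + 1), a i y (iteratedFDeriv 𝕜 i (localRep 𝕜 B FE m s) y) := by
  obtain ⟨a, ha, h⟩ := D.localRep_apply hs
  refine ⟨a, ha, ?_⟩
  have hc : Tendsto (extChartAt 𝓘(𝕜, B) m).symm (𝓝 (extChartAt 𝓘(𝕜, B) m m)) (𝓝 m) := by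
    have := (continuousAt_extChartAt_symm (I := 𝓘(𝕜, B)) m).tendsto
    rwa [extChartAt_to_inv] at this
  filter_upwards [hc.eventually h, extChartAt_target_mem_nhds (I := 𝓘(𝕜, B)) m] with y hy hyt
  rw [(extChartAt 𝓘(𝕜, B) m).right_inv hyt] at hy
  exact hy

/-- If the derivatives of `s` of order `< k + r` vanish at `m`, then those of `D(j^k s)` of order
`< r` vanish at `m`. -/
lemma vanishes_apply {m : V} {s : Π x, E x} (hs : s ∈ analyticSections 𝕜 B FE E m) (r : ℕ)
    (h : VanishesToOrder 𝕜 (k + r) (localRep 𝕜 B FE m s) (extChartAt 𝓘(𝕜, B) m m)) :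
    VanishesToOrder 𝕜 r (localRep 𝕜 B FF m (D.apply s)) (extChartAt 𝓘(𝕜, B) m m) := by
  obtain ⟨a, ha, h'⟩ := D.localRep_apply_chart hs
  refine VanishesToOrder.congr ?_ h'.symm
  have hg : ∀ i, ContDiffAt 𝕜 ω (iteratedFDeriv 𝕜 i (localRep 𝕜 B FE m s))
      (extChartAt 𝓘(𝕜, B) m m) := fun i =>
    (contDiffAt_localRep 𝕜 B FE hs).iteratedFDeriv_right (by simp)
  have key : ∀ N ≤ k + 1, VanishesToOrder 𝕜 r (fun y => ∑ i ∈ Finset.range N,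
      a i y (iteratedFDeriv 𝕜 i (localRep 𝕜 B FE m s) y)) (extChartAt 𝓘(𝕜, B) m m) := by
    intro N
    induction N with
    | zero => intro _; simpa using vanishesToOrder_zero (𝕜 := 𝕜) (G := FF) r _
    | succ N ih =>
      intro hN
      simp only [Finset.sum_range_succ]
      exact VanishesToOrder.add (ContDiffAt.sum fun i _ => (ha i).clm_apply (hg i))
        ((ha N).clm_apply (hg N)) (ih (by omega))
        (VanishesToOrder.clm_apply (ha N) (hg N) (h.mono (by omega)).iteratedFDeriv)
  exact key _ le_rfl

lemma apply_add {m : V} (s t : analyticSections 𝕜 B FE E m) :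
    ∀ᶠ x in 𝓝 m, D.apply (s.1 + t.1) x = D.apply s.1 x + D.apply t.1 x := by
  filter_upwards [analyticSections_eventually 𝕜 B FE s.2,
    analyticSections_eventually 𝕜 B FE t.2] with x hs ht
  rw [apply, apply, apply, jetAt_of_mem 𝕜 B FE k hs, jetAt_of_mem 𝕜 B FE k ht,
    jetAt_of_mem 𝕜 B FE k (add_mem hs ht), ← map_add, ← map_add]
  rfl

lemma apply_smul {m : V} (b : 𝕜) (s : analyticSections 𝕜 B FE E m) :
    ∀ᶠ x in 𝓝 m, D.apply (b • s.1) x = b • D.apply s.1 x := by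
  filter_upwards [analyticSections_eventually 𝕜 B FE s.2] with x hs
  rw [apply, apply, jetAt_of_mem 𝕜 B FE k hs,
    jetAt_of_mem 𝕜 B FE k (Submodule.smul_mem _ b hs), ← map_smul, ← map_smul]
  rfl

lemma apply_null {m : V} (s : analyticSections 𝕜 B FE E m) (hs : s ∈ nullSections 𝕜 B FE E m) :
    ∀ᶠ x in 𝓝 m, D.apply s.1 x = 0 := by
  have hs' : ∀ᶠ x in 𝓝 m, s.1 x = 0 := hs
  filter_upwards [analyticSections_eventually 𝕜 B FE s.2, hs'.eventually_nhds] with x h1 h2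
  have h3 : (vanishing 𝕜 B FE E x (k + 1)).mkQ ⟨s.1, h1⟩ = 0 := by
    rw [Submodule.mkQ_apply, Submodule.Quotient.mk_eq_zero]
    exact nullSections_le_vanishing 𝕜 B FE E x (k + 1) h2
  rw [apply, jetAt_of_mem 𝕜 B FE k h1, h3, map_zero]

/-- The operator `s ↦ D(j^k s)` from germs at `m` of sections of `E` to germs at `m` of sections
of `F`. -/
def onGerms (m : V) : SectionGerm 𝕜 B FE E m →ₗ[𝕜] SectionGerm 𝕜 B FF F m :=
  (nullSections 𝕜 B FE E m).liftQ
    { toFun := fun s => (nullSections 𝕜 B FF F m).mkQ ⟨D.apply s.1, D.apply_mem s.2⟩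
      map_add' := fun s t => by
        rw [← map_add, ← sub_eq_zero, ← map_sub, Submodule.mkQ_apply,
          Submodule.Quotient.mk_eq_zero]
        filter_upwards [D.apply_add s t] with x hx
        exact sub_eq_zero.2 hx
      map_smul' := fun b s => by
        rw [RingHom.id_apply, ← map_smul, ← sub_eq_zero, ← map_sub, Submodule.mkQ_apply,
          Submodule.Quotient.mk_eq_zero]
        filter_upwards [D.apply_smul b s] with x hx
        exact sub_eq_zero.2 hx }
    (fun s hs => by
      rw [LinearMap.mem_ker]
      change (nullSections 𝕜 B FF F m).mkQ ⟨D.apply s.1, D.apply_mem s.2⟩ = 0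
      rw [Submodule.mkQ_apply, Submodule.Quotient.mk_eq_zero]
      exact D.apply_null s hs)

/-- The space `S_m` of germs at `m` of solutions of `D(j^k s) = 0`. -/
def solutionGerms (m : V) : Submodule 𝕜 (SectionGerm 𝕜 B FE E m) := LinearMap.ker (D.onGerms m)

/-- The `l`-th prolongation `D_{k+l} : J^{k+l} E → J^l F` of `D` at the point `m`, obtained by
successive derivations: it maps `j^{k+l}_m s` to `j^l_m (D(j^k s))`. -/
def prolong (l : ℕ) (m : V) : Jet 𝕜 B FE E (k + l) m →ₗ[𝕜] Jet 𝕜 B FF F l m :=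
  (vanishing 𝕜 B FE E m (k + l + 1)).liftQ
    (SectionGerm.jet 𝕜 B FF F l m ∘ₗ D.onGerms m ∘ₗ (nullSections 𝕜 B FE E m).mkQ)
    (fun s hs => by
      rw [LinearMap.mem_ker]
      change (vanishing 𝕜 B FF F m (l + 1)).mkQ ⟨D.apply s.1, D.apply_mem s.2⟩ = 0
      rw [Submodule.mkQ_apply, Submodule.Quotient.mk_eq_zero]
      exact D.vanishes_apply s.2 (l + 1) hs)

lemma prolong_mem_topJet (l : ℕ) (m : V) :
    ∀ r ∈ topJet 𝕜 B FE E (k + l) m, D.prolong l m r ∈ topJet 𝕜 B FF F l m := by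
  rintro _ ⟨s, hs, rfl⟩
  exact ⟨⟨D.apply s.1, D.apply_mem s.2⟩, D.vanishes_apply s.2 l hs, rfl⟩

/-- The principal symbol `σ_{k+l}(D) : S^{k+l} T^*(V) ⊗ E → S^l T^*(V) ⊗ F` at the point `m`: the
restriction of the prolongation `D_{k+l}` to the kernel of `J^{k+l} E → J^{k+l-1} E`. -/
def symbol (l : ℕ) (m : V) : topJet 𝕜 B FE E (k + l) m →ₗ[𝕜] topJet 𝕜 B FF F l m :=
  (D.prolong l m).restrict (D.prolong_mem_topJet l m)

/-- `D` is ordinary if, for any `h = k + l ≥ k` and at any point, the principal symbol `σ_h(D)`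
has the maximal rank `inf (q c(n,h-k), p c(n,h))`, where `n = dim V`, `p = rank E`,
`q = rank F`. -/
def IsOrdinary : Prop := ∀ (m : V) (l : ℕ),
  finrank 𝕜 (LinearMap.range (D.symbol l m)) =
    min (finrank 𝕜 FF * c (finrank 𝕜 B) l) (finrank 𝕜 FE * c (finrank 𝕜 B) (k + l))

end LinDiffOp

end JetPDE

end

noncomputable section

namespace JetPDE

/-! ### Binomial identities and the integer `h₀` -/

/-! Filter the solution germs at `m` by order of vanishing. A solution vanishing to order `r` has an
`r`-jet in the top part of the jet space, and this jet is zero exactly when the solution vanishes to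
order `r + 1`. So the `r`-th graded piece embeds in the top jets, whose dimension is at most `p
c(n,r)` (`finrank_topJet_le`). If `r ≥ k`, prolonging the equation puts the jet in the kernel of the
symbol `σ_r(D)` (`jet_mem_map_ker_symbol`). By rank-nullity and maximality of the rank, that kernel
has dimension at most the positive part of `p c(n,r) - q c(n,r-k)`.

For `r > h₀` this positive part is zero. A solution vanishing to order `h₀ + 1` therefore vanishes
to every order, and by analyticity its germ is zero (`solutionFiltration_eq_bot`). This gives
determination by the `h₀`-jet, and the filtration is finite with finite-dimensional pieces.

The bound is the sum of the graded bounds for `r ≤ h₀`. Since `φ` is nondecreasing with limit 1 and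
`p < q`, the integer `h₀` exists, and no difference with `k ≤ r ≤ h₀` is negative. The identity
`c(n+1,h) = ∑_{i ≤ h} c(n,i)` then evaluates the sum to `π(n,k,p,q)` (`sum_gradedBound`). -/

lemma c_pos (n h : ℕ) : 0 < c n h := Nat.choose_pos (Nat.le_add_left _ _)

lemma c_zero_right (n : ℕ) : c n 0 = 1 := Nat.choose_zero_right _

lemma c_succ_mul {n : ℕ} (hn : 1 ≤ n) (h : ℕ) : c n (h + 1) * (h + 1) = (n + h) * c n h := by
  obtain ⟨n, rfl⟩ := Nat.exists_eq_add_of_le' hn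
  have := Nat.add_one_mul_choose_eq (n + h) h
  simp only [c, Nat.add_sub_cancel]
  rw [show n + 1 + h = n + h + 1 by ring, show n + (h + 1) = n + h + 1 by ring]
  exact this.symm

/-- Hockey-stick identity: homogenizing with one more variable turns monomials of degree at most `h`
into monomials of degree exactly `h`. -/
lemma c_succ_left {n : ℕ} (hn : 1 ≤ n) (h : ℕ) :
    c (n + 1) h = ∑ i ∈ Finset.range (h + 1), c n i := by
  obtain ⟨n, rfl⟩ := Nat.exists_eq_add_of_le' hn
  induction h with
  | zero => simp [c]
  | succ h ih =>
    rw [Finset.sum_range_succ, ← ih]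
    simp only [c, Nat.add_sub_cancel]
    rw [show n + 1 + (h + 1) = n + 1 + h + 1 by ring, Nat.choose_succ_succ,
      show n + (h + 1) = n + 1 + h by ring]

/-- The ratio is a product of `k` consecutive factors `c(n,j+1)/c(n,j) = 1 + (n-1)/(j+1)`, each
tending to 1. -/
lemma tendsto_c_ratio {n : ℕ} (hn : 1 ≤ n) (k : ℕ) :
    Tendsto (fun l : ℕ => (c n (k + l) : ℝ) / c n l) atTop (𝓝 1) := by
  induction k with
  | zero =>
    refine tendsto_const_nhds.congr fun l => ?_
    rw [zero_add, div_self (by exact_mod_cast (c_pos n l).ne')]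
  | succ k ih =>
    have h1 : Tendsto (fun l : ℕ => 1 + ((n : ℝ) - 1) / ((l + (k + 1) : ℕ) : ℝ)) atTop
        (𝓝 (1 + 0)) :=
      tendsto_const_nhds.add ((tendsto_const_div_atTop_nhds_zero_nat _).comp
        (tendsto_add_atTop_nat (k + 1)))
    have h2 := h1.mul ih
    rw [add_zero, one_mul] at h2
    refine h2.congr fun l => ?_
    have hc : (c n l : ℝ) ≠ 0 := by exact_mod_cast (c_pos n l).ne'
    have hs : (c n (k + l + 1) : ℝ) * ((k + l : ℕ) + 1) = (n + (k + l : ℕ)) * c n (k + l) := by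
      exact_mod_cast c_succ_mul hn (k + l)
    have hkl : ((k : ℝ) + l + 1) ≠ 0 := by positivity
    rw [show k + 1 + l = k + l + 1 by ring]
    push_cast at hs ⊢
    rw [show (l : ℝ) + (k + 1) = k + l + 1 by ring]
    field_simp
    linear_combination -hs

/-- Since `p c(n,k+l) / c(n,l)` tends to `p < q`, the inequality fails for all large `l`. -/
lemma bddAbove_prolongation_orders {n k p q : ℕ} (hn : 1 ≤ n) (hpq : p < q) :
    BddAbove {h : ℕ | k ≤ h ∧ q * c n (h - k) ≤ p * c n h} := by
  have h1 := (tendsto_c_ratio hn k).const_mul (p : ℝ)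
  rw [mul_one] at h1
  obtain ⟨N, hN⟩ := eventually_atTop.1 (h1.eventually_lt_const
    (show (p : ℝ) < q by exact_mod_cast hpq))
  refine ⟨k + N, fun h ⟨hkh, hh⟩ => ?_⟩
  obtain ⟨l, rfl⟩ := Nat.exists_eq_add_of_le hkh
  by_contra! hlt
  have h2 := hN l (by omega)
  have hc : (0 : ℝ) < c n l := by exact_mod_cast c_pos n l
  rw [← mul_div_assoc, div_lt_iff₀ hc] at h2
  rw [Nat.add_sub_cancel_left] at hh
  exact absurd hh (not_le.2 (by exact_mod_cast h2))

lemma isGreatest_h₀ {n k p q : ℕ} (hn : 1 ≤ n) (hpq : p < q) (hqp : q ≤ p * c n k) :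
    IsGreatest {h : ℕ | k ≤ h ∧ q * c n (h - k) ≤ p * c n h} (h₀ n k p q) := by
  have hb := bddAbove_prolongation_orders (k := k) hn hpq
  -- The hypothesis `q ≤ p c(n,k)` says that `k` itself belongs to the set; being nonempty and
  -- bounded, the set contains its supremum.
  refine ⟨Nat.sSup_mem ⟨k, le_rfl, ?_⟩ hb, fun h hh => le_csSup hb hh⟩
  rwa [Nat.sub_self, c_zero_right, mul_one]

/-- Monotonicity of `φ` with denominators cleared, so that the inequality descends from `h₀` to
every order between `k` and `h₀`. -/
lemma mul_c_le_of_succ {n k p q l : ℕ} (hn : 1 ≤ n)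
    (h : q * c n (l + 1) ≤ p * c n (k + (l + 1))) : q * c n l ≤ p * c n (k + l) := by
  have h1 := c_succ_mul hn l
  have h2 := c_succ_mul hn (k + l)
  rw [← add_assoc] at h
  -- The two sides differ by `k (n - 1)`.
  have h3 : (n + (k + l)) * (l + 1) ≤ (n + l) * (k + l + 1) := by
    obtain ⟨n, rfl⟩ := Nat.exists_eq_add_of_le' hn
    nlinarith [Nat.zero_le (n * k)]
  refine Nat.le_of_mul_le_mul_left (c := (n + l) * (k + l + 1)) ?_ (by positivity)
  calc (n + l) * (k + l + 1) * (q * c n l)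
      = (q * c n (l + 1)) * ((l + 1) * (k + l + 1)) := by linear_combination q * (k + l + 1) * h1.symm
    _ ≤ (p * c n (k + l + 1)) * ((l + 1) * (k + l + 1)) := Nat.mul_le_mul_right _ h
    _ = (n + (k + l)) * (l + 1) * (p * c n (k + l)) := by linear_combination p * (l + 1) * h2
    _ ≤ _ := Nat.mul_le_mul_right _ h3

lemma mul_c_le_of_le {n k p q L : ℕ} (hn : 1 ≤ n) (h : q * c n L ≤ p * c n (k + L)) {l : ℕ}
    (hl : l ≤ L) : q * c n l ≤ p * c n (k + l) := by
  induction hl using Nat.decreasingInduction with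
  | self => exact h
  | of_succ l _ ih => exact mul_c_le_of_succ hn ih

/-- The generic dimension of the space of solutions of order exactly `r`. -/
def gradedBound (n k p q r : ℕ) : ℕ :=
  p * c n r - if k ≤ r then q * c n (r - k) else 0

/-- The truncated subtractions are genuine ones because the inequality at `L` propagates to all `l ≤
L`; the two sums are then hockey-stick sums. -/
lemma sum_gradedBound {n k p q L : ℕ} (hn : 1 ≤ n) (h : q * c n L ≤ p * c n (k + L)) :
    ((∑ r ∈ Finset.range (k + L + 1), gradedBound n k p q r : ℕ) : ℤ) =
      p * c (n + 1) (k + L) - q * c (n + 1) L := by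
  rw [c_succ_left hn, c_succ_left hn, add_assoc, Finset.sum_range_add _ k (L + 1),
    Finset.sum_range_add _ k (L + 1)]
  have h1 : ∀ r ∈ Finset.range k, gradedBound n k p q r = p * c n r := fun r hr => by
    rw [gradedBound, if_neg (not_le.2 (Finset.mem_range.1 hr)), Nat.sub_zero]
  have h2 : ∀ l ∈ Finset.range (L + 1), ((gradedBound n k p q (k + l) : ℕ) : ℤ) =
      p * c n (k + l) - q * c n l := fun l hl => by
    rw [gradedBound, if_pos (Nat.le_add_right _ _), Nat.add_sub_cancel_left,
      Nat.cast_sub (mul_c_le_of_le hn h (by simpa [Nat.lt_succ_iff] using hl))]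
    push_cast; ring
  rw [Finset.sum_congr rfl h1]
  push_cast
  rw [Finset.sum_congr rfl h2, Finset.sum_sub_distrib, ← Finset.mul_sum, ← Finset.mul_sum,
    ← Finset.mul_sum]
  ring

/-- The orders below `k` add up to `c(n+1,k-1)`, and `c(n,h) φ(h) = c(n,h-k)` gives the remaining
terms. -/
lemma piBound_eq_sum {n k p q : ℕ} (hn : 1 ≤ n) (hk : 1 ≤ k) (hh : k ≤ h₀ n k p q) :
    (piBound n k p q : ℚ) = (p : ℚ) * (c (n + 1) (k - 1) : ℚ) +
      ∑ h ∈ Finset.Icc k (h₀ n k p q),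
        (Nat.choose (n - 1 + h) h : ℚ) * ((p : ℚ) - (q : ℚ) * phi n k h) := by
  obtain ⟨L, hL⟩ := Nat.exists_eq_add_of_le hh
  rw [piBound, hL, ← Finset.Ico_add_one_right_eq_Icc, Finset.sum_Ico_eq_sum_range,
    show k + L + 1 - k = L + 1 by omega, Nat.add_sub_cancel_left, c_succ_left hn, c_succ_left hn,
    c_succ_left hn, Nat.sub_add_cancel hk, add_assoc k, Finset.sum_range_add]
  have h2 : ∀ l ∈ Finset.range (L + 1),
      (Nat.choose (n - 1 + (k + l)) (k + l) : ℚ) * ((p : ℚ) - (q : ℚ) * phi n k (k + l)) =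
      p * c n (k + l) - q * c n l := fun l _ => by
    have hc : (c n (k + l) : ℚ) ≠ 0 := by exact_mod_cast (c_pos n _).ne'
    rw [phi, Nat.add_sub_cancel_left]
    change (c n (k + l) : ℚ) * _ = _
    field_simp
  rw [Finset.sum_congr rfl h2, Finset.sum_sub_distrib, ← Finset.mul_sum, ← Finset.mul_sum]
  push_cast
  ring

/-! ### Dimension of spaces of symmetric multilinear maps -/

lemma exists_monotone_ofFn {n h : ℕ} (σ : Sym (Fin n) h) :
    ∃ t : Fin h → Fin n, Monotone t ∧ (List.ofFn t : Multiset (Fin n)) = σ.1 := by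
  obtain ⟨⟨l⟩, hl⟩ := σ
  have hl' : l.length = h := hl
  subst hl'
  refine ⟨l.get ∘ Tuple.sort l.get, Tuple.monotone_sort _, ?_⟩
  rw [show (⟨Quot.mk _ l, hl⟩ : Sym (Fin n) l.length).1 = (l : Multiset (Fin n)) from rfl,
    Multiset.coe_eq_coe]
  exact (Equiv.Perm.ofFn_comp_perm _ _).trans (by rw [List.ofFn_get])

/-- The nondecreasing tuple with given underlying multiset. -/
def sortedTuple {n h : ℕ} (σ : Sym (Fin n) h) : Fin h → Fin n := (exists_monotone_ofFn σ).choose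

/-- Sorting `v` gives a nondecreasing tuple with the same multiset of entries, and only one such
tuple exists. -/
lemma exists_sortedTuple_eq {n h : ℕ} (v : Fin h → Fin n) :
    ∃ (σ : Sym (Fin n) h) (τ : Equiv.Perm (Fin h)), sortedTuple σ = v ∘ τ := by
  refine ⟨⟨List.ofFn v, by simp⟩, Tuple.sort v, ?_⟩
  obtain ⟨h1, h2⟩ := (exists_monotone_ofFn (⟨List.ofFn v, by simp⟩ : Sym (Fin n) h)).choose_spec
  refine List.ofFn_injective (List.Perm.eq_of_pairwise' (r := (· ≤ ·)) ?_ ?_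
    ((Multiset.coe_eq_coe.1 h2).trans (Equiv.Perm.ofFn_comp_perm _ _).symm))
  · exact List.pairwise_ofFn.2 fun _ _ hij => h1 hij.le
  · exact List.pairwise_ofFn.2 fun _ _ hij => Tuple.monotone_sort v hij.le

section Multilinear

variable {𝕜 : Type*} [RCLike 𝕜]
  {B : Type*} [NormedAddCommGroup B] [NormedSpace 𝕜 B]
  {G : Type*} [NormedAddCommGroup G] [NormedSpace 𝕜 G]

/-- The values of a multilinear map at the nondecreasing tuples of basis vectors. -/
def evalSorted {n : ℕ} (b : Basis (Fin n) 𝕜 B) (h : ℕ) :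
    (B [×h]→L[𝕜] G) →ₗ[𝕜] (Sym (Fin n) h → G) where
  toFun f σ := f (b ∘ sortedTuple σ)
  map_add' _ _ := rfl
  map_smul' _ _ := rfl

/-- By symmetry, the value at any tuple of basis vectors equals the value at the sorted tuple. -/
lemma eq_zero_of_evalSorted_eq_zero {n h : ℕ} (b : Basis (Fin n) 𝕜 B) {f : B [×h]→L[𝕜] G}
    (hf : ∀ (v : Fin h → B) (τ : Equiv.Perm (Fin h)), f (v ∘ τ) = f v)
    (h0 : evalSorted b h f = 0) : f = 0 := by
  refine ContinuousMultilinearMap.toMultilinearMap_injective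
    (Basis.ext_multilinear (fun _ => b) fun v => ?_)
  obtain ⟨σ, τ, hσ⟩ := exists_sortedTuple_eq v
  have h1 : f (b ∘ sortedTuple σ) = 0 := congrFun h0 σ
  rw [hσ, ← Function.comp_assoc, hf] at h1
  exact h1

end Multilinear

/-! ### Dimension count along one step of a filtration, and analytic uniqueness -/

section LinearAlgebra

variable {K W X : Type*} [Field K] [AddCommGroup W] [Module K W] [AddCommGroup X] [Module K X]

/-- One step of the estimate of the dimension of a filtered space. -/
lemma finrank_le_add_of_ker_le (f : W →ₗ[K] X) {A A' : Submodule K W} {T : Submodule K X}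
    [FiniteDimensional K A'] [FiniteDimensional K T] (hk : A ⊓ LinearMap.ker f ≤ A')
    (hT : A.map f ≤ T) :
    FiniteDimensional K A ∧ finrank K A ≤ finrank K A' + finrank K T := by
  have hAT : FiniteDimensional K (A.map f) := Submodule.finiteDimensional_of_le hT
  have hAk : FiniteDimensional K (A ⊓ LinearMap.ker f : Submodule K W) :=
    Submodule.finiteDimensional_of_le hk
  have hA : FiniteDimensional K A := Module.Finite.iff_fg.2
    (Submodule.fg_of_fg_map_of_fg_inf_ker f (Module.Finite.iff_fg.1 hAT)
      (Module.Finite.iff_fg.1 hAk))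
  refine ⟨hA, ?_⟩
  rw [← LinearMap.finrank_range_add_finrank_ker (f.domRestrict A), LinearMap.range_domRestrict,
    add_comm]
  refine add_le_add ?_ (Submodule.finrank_mono hT)
  -- The kernel of the restriction lives inside the subtype `A`; this injection carries it into `W`,
  -- where it lands in `A'`.
  have hinj : Function.Injective (A.subtype ∘ₗ (LinearMap.ker (f.domRestrict A)).subtype) :=
    (Submodule.subtype_injective A).comp (Submodule.subtype_injective _)
  rw [← LinearMap.finrank_range_of_inj hinj]
  refine Submodule.finrank_mono (le_trans ?_ hk)
  rintro _ ⟨⟨a, ha⟩, rfl⟩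
  exact ⟨a.2, ha⟩

end LinearAlgebra

/-- An analytic function all of whose derivatives vanish at a point vanishes near that point. -/
lemma eventually_eq_zero_of_vanishesToOrder {𝕜 : Type*} [RCLike 𝕜]
    {B : Type*} [NormedAddCommGroup B] [NormedSpace 𝕜 B]
    {G : Type*} [NormedAddCommGroup G] [NormedSpace 𝕜 G] [CompleteSpace G]
    {f : B → G} {y : B} (hf : ContDiffAt 𝕜 ω f y) (h : ∀ r, VanishesToOrder 𝕜 r f y) :
    ∀ᶠ z in 𝓝 y, f z = 0 := by
  obtain ⟨P, r, hP⟩ := hf.analyticAt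
  filter_upwards [Metric.eball_mem_nhds y hP.r_pos] with z hz
  have h1 := hP.hasSum_iteratedFDeriv (y := z - y) (by
    rwa [Metric.mem_eball, edist_zero_right, ← edist_eq_enorm_sub])
  rw [add_sub_cancel] at h1
  refine h1.unique ?_
  convert hasSum_zero with i
  rw [h (i + 1) i (Nat.lt_succ_self i)]
  simp

/-! ### Derivatives at a point and the dimension of the top jets -/

section Jets

variable (𝕜 : Type*) [RCLike 𝕜]
  (B : Type*) [NormedAddCommGroup B] [NormedSpace 𝕜 B]
  {V : Type*} [TopologicalSpace V] [ChartedSpace B V]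
  (FE : Type*) [NormedAddCommGroup FE] [NormedSpace 𝕜 FE]
  (E : V → Type*) [TopologicalSpace (TotalSpace FE E)]
  [∀ x, AddCommGroup (E x)] [∀ x, Module 𝕜 (E x)] [∀ x, TopologicalSpace (E x)]
  [FiberBundle FE E] [VectorBundle 𝕜 FE E]

/-- The `h`-th derivative at `m` of a section analytic near `m`. -/
def derivAt (h : ℕ) (m : V) : analyticSections 𝕜 B FE E m →ₗ[𝕜] (B [×h]→L[𝕜] FE) where
  toFun s := iteratedFDeriv 𝕜 h (localRep 𝕜 B FE m s.1) (extChartAt 𝓘(𝕜, B) m m)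
  map_add' s t := by
    have he : localRep 𝕜 B FE m (s + t).1 =ᶠ[𝓝 (extChartAt 𝓘(𝕜, B) m m)]
        localRep 𝕜 B FE m s.1 + localRep 𝕜 B FE m t.1 := by
      filter_upwards [localRep_eq 𝕜 B FE m s.1, localRep_eq 𝕜 B FE m t.1,
        localRep_eq 𝕜 B FE m (s + t).1] with y h1 h2 h3
      rw [Pi.add_apply, h1, h2, h3]
      exact map_add _ _ _
    rw [(he.iteratedFDeriv (𝕜 := 𝕜) h).eq_of_nhds, iteratedFDeriv_add_apply
      ((contDiffAt_localRep 𝕜 B FE s.2).of_le le_top)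
      ((contDiffAt_localRep 𝕜 B FE t.2).of_le le_top)]
  map_smul' a s := by
    have he : localRep 𝕜 B FE m (a • s).1 =ᶠ[𝓝 (extChartAt 𝓘(𝕜, B) m m)]
        a • localRep 𝕜 B FE m s.1 := by
      filter_upwards [localRep_eq 𝕜 B FE m s.1,
        localRep_eq 𝕜 B FE m (a • s).1] with y h1 h2
      rw [Pi.smul_apply, h1, h2]
      exact map_smul _ _ _
    rw [(he.iteratedFDeriv (𝕜 := 𝕜) h).eq_of_nhds, iteratedFDeriv_const_smul_apply
      ((contDiffAt_localRep 𝕜 B FE s.2).of_le le_top), RingHom.id_apply]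

variable {𝕜 B FE E} in
lemma mem_vanishing_iff {m : V} {r : ℕ} {s : analyticSections 𝕜 B FE E m} :
    s ∈ vanishing 𝕜 B FE E m r ↔ ∀ i < r, derivAt 𝕜 B FE E i m s = 0 := Iff.rfl

lemma vanishing_zero (m : V) : vanishing 𝕜 B FE E m 0 = ⊤ :=
  eq_top_iff.2 fun _ _ => mem_vanishing_iff.2 fun _ hi => absurd hi (Nat.not_lt_zero _)

variable {𝕜 B FE E} in
lemma mem_vanishing_succ_iff {m : V} {r : ℕ} {s : analyticSections 𝕜 B FE E m}
    (hs : s ∈ vanishing 𝕜 B FE E m r) :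
    s ∈ vanishing 𝕜 B FE E m (r + 1) ↔ derivAt 𝕜 B FE E r m s = 0 :=
  ⟨fun h => mem_vanishing_iff.1 h r r.lt_succ_self, fun h => mem_vanishing_iff.2 fun i hi =>
    (Nat.lt_succ_iff_lt_or_eq.1 hi).elim (mem_vanishing_iff.1 hs i) fun e => e ▸ h⟩

/-- The `h`-th derivative at `m` of an `h`-jet. -/
def jetDeriv (h : ℕ) (m : V) : Jet 𝕜 B FE E h m →ₗ[𝕜] (B [×h]→L[𝕜] FE) :=
  (vanishing 𝕜 B FE E m (h + 1)).liftQ (derivAt 𝕜 B FE E h m)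
    fun _ hs => mem_vanishing_iff.1 hs h h.lt_succ_self

variable [FiniteDimensional 𝕜 B]

/-- A top jet, read through the values of its symmetric multilinear map on basis vectors. -/
def topJetCoord (h : ℕ) (m : V) :
    topJet 𝕜 B FE E h m →ₗ[𝕜] (Sym (Fin (finrank 𝕜 B)) h → FE) :=
  evalSorted (finBasis 𝕜 B) h ∘ₗ jetDeriv 𝕜 B FE E h m ∘ₗ (topJet 𝕜 B FE E h m).subtype

/-- Lower derivatives of a top jet vanish, so it is determined by its `h`-th derivative, a symmetric
multilinear map. Injectivity suffices, as only an upper bound on the dimension is needed. -/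
lemma topJetCoord_injective (h : ℕ) (m : V) :
    Function.Injective (topJetCoord 𝕜 B FE E h m) := by
  rw [← LinearMap.ker_eq_bot, LinearMap.ker_eq_bot']
  rintro ⟨_, s, hs, rfl⟩ h0
  have h1 : derivAt 𝕜 B FE E h m s = 0 :=
    eq_zero_of_evalSorted_eq_zero (finBasis 𝕜 B)
      (fun v τ => (contDiffAt_localRep 𝕜 B FE s.2).iteratedFDeriv_comp_perm v τ) h0
  rw [Subtype.ext_iff]
  exact (Submodule.Quotient.mk_eq_zero _).2 ((mem_vanishing_succ_iff hs).2 h1)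

variable [FiniteDimensional 𝕜 FE]

instance finiteDimensional_topJet (h : ℕ) (m : V) :
    FiniteDimensional 𝕜 (topJet 𝕜 B FE E h m) :=
  FiniteDimensional.of_injective _ (topJetCoord_injective 𝕜 B FE E h m)

lemma finrank_topJet_le (hB : 1 ≤ finrank 𝕜 B) (h : ℕ) (m : V) :
    finrank 𝕜 (topJet 𝕜 B FE E h m) ≤ finrank 𝕜 FE * c (finrank 𝕜 B) h := by
  refine (LinearMap.finrank_le_finrank_of_injective
    (topJetCoord_injective 𝕜 B FE E h m)).trans (le_of_eq ?_)
  -- Multisets of size `h` in `n` letters number `c(n,h)`; `n ≥ 1` matters because `n - 1` is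
  -- truncated in `c`.
  rw [finrank_pi_fintype, Finset.sum_const, Finset.card_univ, Sym.card_sym_eq_choose,
    Fintype.card_fin, smul_eq_mul, mul_comm, c,
    show finrank 𝕜 B + h - 1 = finrank 𝕜 B - 1 + h by omega]

end Jets

/-! ### Solution germs filtered by order of vanishing -/

namespace LinDiffOp

variable {𝕜 : Type*} [RCLike 𝕜]
  {B : Type*} [NormedAddCommGroup B] [NormedSpace 𝕜 B]
  {V : Type*} [TopologicalSpace V] [ChartedSpace B V]
  {FE : Type*} [NormedAddCommGroup FE] [NormedSpace 𝕜 FE]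
  {E : V → Type*} [TopologicalSpace (TotalSpace FE E)]
  [∀ x, AddCommGroup (E x)] [∀ x, Module 𝕜 (E x)] [∀ x, TopologicalSpace (E x)]
  [FiberBundle FE E] [VectorBundle 𝕜 FE E]
  {FF : Type*} [NormedAddCommGroup FF] [NormedSpace 𝕜 FF]
  {F : V → Type*} [TopologicalSpace (TotalSpace FF F)]
  [∀ x, AddCommGroup (F x)] [∀ x, Module 𝕜 (F x)] [∀ x, TopologicalSpace (F x)]
  [FiberBundle FF F] [VectorBundle 𝕜 FF F] {k : ℕ}
  (D : LinDiffOp 𝕜 B FE E FF F k)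
  [IsManifold 𝓘(𝕜, B) ω V] [ContMDiffVectorBundle ω FE E 𝓘(𝕜, B)]

/-- The germs at `m` of solutions whose derivatives of order `< r` vanish at `m`. -/
def solutionFiltration (m : V) (r : ℕ) : Submodule 𝕜 (SectionGerm 𝕜 B FE E m) :=
  (vanishing 𝕜 B FE E m r).map (nullSections 𝕜 B FE E m).mkQ ⊓ D.solutionGerms m

lemma solutionFiltration_zero (m : V) : D.solutionFiltration m 0 = D.solutionGerms m := by
  rw [solutionFiltration, vanishing_zero, Submodule.map_top, Submodule.range_mkQ, top_inf_eq]

variable {D} in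
lemma mem_solutionFiltration_succ {m : V} {r : ℕ} {σ : SectionGerm 𝕜 B FE E m}
    (hσ : σ ∈ D.solutionGerms m) (hj : SectionGerm.jet 𝕜 B FE E r m σ = 0) :
    σ ∈ D.solutionFiltration m (r + 1) := by
  refine ⟨?_, hσ⟩
  obtain ⟨s, rfl⟩ := Submodule.mkQ_surjective _ σ
  exact ⟨s, (Submodule.Quotient.mk_eq_zero _).1 hj, rfl⟩

lemma jet_mem_topJet {m : V} {r : ℕ} {σ : SectionGerm 𝕜 B FE E m}
    (hσ : σ ∈ D.solutionFiltration m r) :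
    SectionGerm.jet 𝕜 B FE E r m σ ∈ topJet 𝕜 B FE E r m := by
  obtain ⟨⟨s, hs, rfl⟩, -⟩ := hσ
  exact ⟨s, hs, rfl⟩

lemma prolong_jet {m : V} {l : ℕ} {σ : SectionGerm 𝕜 B FE E m} (hσ : σ ∈ D.solutionGerms m) :
    D.prolong l m (SectionGerm.jet 𝕜 B FE E (k + l) m σ) = 0 := by
  obtain ⟨s, rfl⟩ := Submodule.mkQ_surjective _ σ
  change SectionGerm.jet 𝕜 B FF F l m (D.onGerms m ((nullSections 𝕜 B FE E m).mkQ s)) = 0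
  rw [LinearMap.mem_ker.1 hσ, map_zero]

/-- On top jets the symbol is the prolongation, and the prolongation sends the jet of `s` to the jet
of `D(j^k s) = 0`. -/
lemma jet_mem_map_ker_symbol {m : V} {l : ℕ} {σ : SectionGerm 𝕜 B FE E m}
    (hσ : σ ∈ D.solutionFiltration m (k + l)) :
    SectionGerm.jet 𝕜 B FE E (k + l) m σ ∈
      (LinearMap.ker (D.symbol l m)).map (topJet 𝕜 B FE E (k + l) m).subtype :=
  ⟨⟨_, D.jet_mem_topJet hσ⟩, LinearMap.mem_ker.2 (Subtype.ext (D.prolong_jet hσ.2)), rfl⟩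

variable [FiniteDimensional 𝕜 B] [FiniteDimensional 𝕜 FE]

variable {D} in
-- Rank-nullity; the subtraction is truncated, so the same bound also yields injectivity once `q
-- c(n,l) ≥ p c(n,k+l)`.
lemma IsOrdinary.finrank_ker_symbol_le (hD : D.IsOrdinary) (hB : 1 ≤ finrank 𝕜 B) (m : V)
    (l : ℕ) : finrank 𝕜 (LinearMap.ker (D.symbol l m)) ≤
      finrank 𝕜 FE * c (finrank 𝕜 B) (k + l) - finrank 𝕜 FF * c (finrank 𝕜 B) l := by
  have h1 := LinearMap.finrank_range_add_finrank_ker (D.symbol l m)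
  have h2 := finrank_topJet_le 𝕜 B FE E hB (k + l) m
  rw [hD m l] at h1
  omega

variable {D} in
lemma IsOrdinary.finrank_solutionFiltration_le (hD : D.IsOrdinary) (hB : 1 ≤ finrank 𝕜 B)
    (m : V) (r : ℕ) [FiniteDimensional 𝕜 (D.solutionFiltration m (r + 1))] :
    FiniteDimensional 𝕜 (D.solutionFiltration m r) ∧
    finrank 𝕜 (D.solutionFiltration m r) ≤ finrank 𝕜 (D.solutionFiltration m (r + 1)) +
      gradedBound (finrank 𝕜 B) k (finrank 𝕜 FE) (finrank 𝕜 FF) r := by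
  have hker : D.solutionFiltration m r ⊓ LinearMap.ker (SectionGerm.jet 𝕜 B FE E r m) ≤
      D.solutionFiltration m (r + 1) := fun σ hσ => mem_solutionFiltration_succ hσ.1.2 hσ.2
  by_cases hr : k ≤ r
  · obtain ⟨l, rfl⟩ := Nat.exists_eq_add_of_le hr
    obtain ⟨T, hT⟩ : ∃ T, T = (LinearMap.ker (D.symbol l m)).map
      (topJet 𝕜 B FE E (k + l) m).subtype := ⟨_, rfl⟩
    have hTfin : FiniteDimensional 𝕜 T := hT ▸ inferInstance
    have hmap : (D.solutionFiltration m (k + l)).map (SectionGerm.jet 𝕜 B FE E (k + l) m) ≤ T := by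
      rintro _ ⟨σ, hσ, rfl⟩
      exact hT ▸ D.jet_mem_map_ker_symbol hσ
    have h := finrank_le_add_of_ker_le _ hker hmap
    refine ⟨h.1, h.2.trans (Nat.add_le_add_left ?_ _)⟩
    rw [hT]
    rw [gradedBound, if_pos hr, Nat.add_sub_cancel_left]
    have he := (Submodule.equivMapOfInjective (topJet 𝕜 B FE E (k + l) m).subtype
      (Submodule.subtype_injective _) (LinearMap.ker (D.symbol l m))).finrank_eq
    exact he ▸ hD.finrank_ker_symbol_le hB m l
  · have hmap : (D.solutionFiltration m r).map (SectionGerm.jet 𝕜 B FE E r m) ≤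
        topJet 𝕜 B FE E r m := by
      rintro _ ⟨σ, hσ, rfl⟩
      exact D.jet_mem_topJet hσ
    have h := finrank_le_add_of_ker_le _ hker hmap
    refine ⟨h.1, h.2.trans (Nat.add_le_add_left ?_ _)⟩
    rw [gradedBound, if_neg hr, Nat.sub_zero]
    exact finrank_topJet_le 𝕜 B FE E hB r m

variable {D} in
lemma IsOrdinary.finrank_solutionGerms_le (hD : D.IsOrdinary) (hB : 1 ≤ finrank 𝕜 B)
    (m : V) (r : ℕ) (h0 : D.solutionFiltration m r = ⊥) :
    FiniteDimensional 𝕜 (D.solutionGerms m) ∧ finrank 𝕜 (D.solutionGerms m) ≤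
      ∑ i ∈ Finset.range r, gradedBound (finrank 𝕜 B) k (finrank 𝕜 FE) (finrank 𝕜 FF) i := by
  rw [← solutionFiltration_zero]
  -- Descending induction from the zero step, which supplies the finite-dimensionality that each
  -- larger step needs.
  have key : ∀ j ≤ r, FiniteDimensional 𝕜 (D.solutionFiltration m j) ∧
      finrank 𝕜 (D.solutionFiltration m j) + ∑ i ∈ Finset.range j,
        gradedBound (finrank 𝕜 B) k (finrank 𝕜 FE) (finrank 𝕜 FF) i ≤
      ∑ i ∈ Finset.range r, gradedBound (finrank 𝕜 B) k (finrank 𝕜 FE) (finrank 𝕜 FF) i := by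
    intro j hj
    induction hj using Nat.decreasingInduction with
    | self =>
      rw [h0, finrank_bot, zero_add]
      exact ⟨inferInstance, le_rfl⟩
    | of_succ j _ ih =>
      have := ih.1
      have h1 := hD.finrank_solutionFiltration_le hB m j
      have h2 := ih.2
      rw [Finset.sum_range_succ] at h2
      exact ⟨h1.1, by omega⟩
  simpa using key 0 (Nat.zero_le r)

variable {D} in
/-- Beyond the orders where the symbol can be surjective it is injective, so that a solution
whose derivatives up to some such order vanish is zero. -/
lemma IsOrdinary.solutionFiltration_eq_bot (hD : D.IsOrdinary) (hB : 1 ≤ finrank 𝕜 B) (m : V)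
    (L : ℕ) (hL : ∀ l, L ≤ l → finrank 𝕜 FE * c (finrank 𝕜 B) (k + l) ≤
      finrank 𝕜 FF * c (finrank 𝕜 B) l) :
    D.solutionFiltration m (k + L) = ⊥ := by
  have hcomp : CompleteSpace FE := FiniteDimensional.complete 𝕜 FE
  have hinj : ∀ l, L ≤ l → LinearMap.ker (D.symbol l m) = ⊥ := fun l hl => by
    have h1 := hD.finrank_ker_symbol_le hB m l
    rw [Nat.sub_eq_zero_of_le (hL l hl), Nat.le_zero] at h1
    exact Submodule.finrank_eq_zero.1 h1
  have hstep : ∀ l, L ≤ l → ∀ σ ∈ D.solutionFiltration m (k + l),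
      σ ∈ D.solutionFiltration m (k + (l + 1)) := fun l hl σ hσ => by
    have h1 := D.jet_mem_map_ker_symbol hσ
    rw [hinj l hl, Submodule.map_bot] at h1
    exact mem_solutionFiltration_succ hσ.2 h1
  refine (Submodule.eq_bot_iff _).2 fun σ hσ => ?_
  have hall : ∀ j, σ ∈ D.solutionFiltration m (k + (L + j)) := fun j => by
    induction j with
    | zero => exact hσ
    | succ j ih => exact hstep _ (Nat.le_add_right _ _) σ ih
  obtain ⟨s, rfl⟩ := Submodule.mkQ_surjective _ σ
  -- For each order the filtration only gives some representative `t` of the germ; it differs from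
  -- `s` by a null section, which vanishes to every order.
  have hvan : ∀ r, s ∈ vanishing 𝕜 B FE E m r := fun r => by
    obtain ⟨t, ht, hts⟩ := (hall r).1
    have h1 : s - t ∈ nullSections 𝕜 B FE E m := (Submodule.Quotient.eq _).1 hts.symm
    have h2 := add_mem (nullSections_le_vanishing 𝕜 B FE E m _ h1) ht
    rw [sub_add_cancel] at h2
    exact VanishesToOrder.mono h2 (by omega)
  have h0 := eventually_eq_zero_of_vanishesToOrder (contDiffAt_localRep 𝕜 B FE s.2) hvan
  refine (Submodule.Quotient.mk_eq_zero _).2 ?_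
  change ∀ᶠ x in 𝓝 m, s.1 x = 0
  filter_upwards [(continuousAt_extChartAt (I := 𝓘(𝕜, B)) m).eventually
      (h0.and (localRep_eq 𝕜 B FE m s.1)), extChartAt_source_mem_nhds (I := 𝓘(𝕜, B)) m,
    (trivializationAt FE E m).open_baseSet.mem_nhds
      (FiberBundle.mem_baseSet_trivializationAt' m)] with x hx hxs hxb
  have h1 := hx.2.symm.trans hx.1
  rw [(extChartAt 𝓘(𝕜, B) m).left_inv hxs] at h1
  -- Over the base set the trivialization is invertible on fibres, so a zero local representative
  -- means a zero section.
  rw [← (trivializationAt FE E m).symmL_continuousLinearMapAt (R := 𝕜) hxb (s.1 x), h1, map_zero]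

end LinDiffOp

end JetPDE

end

/-! ### The main theorem -/

open JetPDE in
theorem theorem1 {𝕜 : Type*} [RCLike 𝕜]
    {n k p q : ℕ} (hk : 1 ≤ k)
    {B : Type*} [NormedAddCommGroup B] [NormedSpace 𝕜 B] [FiniteDimensional 𝕜 B]
    (hn : finrank 𝕜 B = n)
    {V : Type*} [TopologicalSpace V] [ChartedSpace B V] [IsManifold 𝓘(𝕜, B) ω V]
    {FE : Type*} [NormedAddCommGroup FE] [NormedSpace 𝕜 FE] [FiniteDimensional 𝕜 FE]
    (hp : finrank 𝕜 FE = p)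
    {E : V → Type*} [TopologicalSpace (TotalSpace FE E)]
    [∀ x, AddCommGroup (E x)] [∀ x, Module 𝕜 (E x)] [∀ x, TopologicalSpace (E x)]
    [FiberBundle FE E] [VectorBundle 𝕜 FE E] [ContMDiffVectorBundle ω FE E 𝓘(𝕜, B)]
    {FF : Type*} [NormedAddCommGroup FF] [NormedSpace 𝕜 FF] [FiniteDimensional 𝕜 FF]
    (hq : finrank 𝕜 FF = q)
    {F : V → Type*} [TopologicalSpace (TotalSpace FF F)]
    [∀ x, AddCommGroup (F x)] [∀ x, Module 𝕜 (F x)] [∀ x, TopologicalSpace (F x)]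
    [FiberBundle FF F] [VectorBundle 𝕜 FF F] [ContMDiffVectorBundle ω FF F 𝓘(𝕜, B)]
    (D : LinDiffOp 𝕜 B FE E FF F k) (hD : D.IsOrdinary)
    (hpq : p < q) (hqp : q ≤ p * c n k) :
    IsGreatest {h : ℕ | k ≤ h ∧ q * c n (h - k) ≤ p * c n h} (h₀ n k p q) ∧
    (piBound n k p q : ℚ) = (p : ℚ) * (c (n + 1) (k - 1) : ℚ) +
      ∑ h ∈ Finset.Icc k (h₀ n k p q),
        (Nat.choose (n - 1 + h) h : ℚ) * ((p : ℚ) - (q : ℚ) * phi n k h) ∧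
    ∀ m : V,
      FiniteDimensional 𝕜 (D.solutionGerms m) ∧
      (finrank 𝕜 (D.solutionGerms m) : ℤ) ≤ piBound n k p q ∧
      ∀ σ ∈ D.solutionGerms m, ∀ τ ∈ D.solutionGerms m,
        SectionGerm.jet 𝕜 B FE E (h₀ n k p q) m σ = SectionGerm.jet 𝕜 B FE E (h₀ n k p q) m τ →
          σ = τ := by
  -- For `n = 0` truncation makes `c 0 k = 1`, and then `q ≤ p` contradicts `p < q`.
  have hn1 : 1 ≤ n := by
    by_contra! h
    obtain rfl : n = 0 := by omega
    simp [c] at hqp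
    omega
  have hg := isGreatest_h₀ hn1 hpq hqp
  refine ⟨hg, piBound_eq_sum hn1 hk hg.1.1, fun m => ?_⟩
  obtain ⟨L, hL⟩ := Nat.exists_eq_add_of_le hg.1.1
  subst hn hp hq
  have hle := hg.1.2
  rw [hL, Nat.add_sub_cancel_left] at hle
  -- Every order `k + l` with `l ≥ L + 1` exceeds `h₀ = k + L`, so maximality reverses the
  -- inequality there.
  have hbot := hD.solutionFiltration_eq_bot hn1 m (L + 1) fun l hl => by
    by_contra! hlt
    have h1 := hg.2 ⟨Nat.le_add_right k l, by rw [Nat.add_sub_cancel_left]; exact hlt.le⟩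
    omega
  obtain ⟨hfin, hrank⟩ := hD.finrank_solutionGerms_le hn1 m _ hbot
  refine ⟨hfin, ?_, fun σ hσ τ hτ hjet => ?_⟩
  · rw [piBound, hL, Nat.add_sub_cancel_left, ← sum_gradedBound hn1 hle]
    exact_mod_cast hrank
  · rw [← sub_eq_zero, ← map_sub, hL] at hjet
    -- The difference of the two solutions has zero `h₀`-jet, so it lies in step `h₀ + 1` of the
    -- filtration, which is zero.
    have h1 := LinDiffOp.mem_solutionFiltration_succ (sub_mem hσ hτ) hjet
    rw [add_assoc, hbot, Submodule.mem_bot] at h1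
    exact sub_eq_zero.1 h1
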